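/- Setting. Let $T>0$, let $(\Omega,\mathcal F,P)$ be a probability space carrying a $d$-dimensional Brownian motion $W$ with augmented filtration $(\mathcal F_t)_{t\in[0,T]}$, and let $\Theta\neq\emptyset$ be a set of progressively measurable processes $\theta:\Omega\times[0,T]\to\mathbb S_d^{>0}$ (symmetric positive definite matrices) with $\int_0^T\|\theta_u^{1/2}\|^2du<\infty$ $P$-a.s. Let $C_0=C_0([0,T];\mathbb R^d)$ be the space of continuous paths started at $0$, with the uniform norm. On $\tilde\Omega=\Omega\times\Theta$ let $\tilde W(\theta)=\int\theta^{1/2}dW$ (a version with all paths in $C_0$), $\tilde{\mathcal F}_t=\sigma(\tilde W_s;s\le t)$, $\tilde W^t_s=\tilde W_{s\wedge t}$, $\tilde P[A]=\sup_{\theta\in\Theta}P[A(\theta)]$ and $\tilde E[X]=\sup_{\theta\in\Theta}E[X(\theta)]$. A property holds quasi-surely (q.s.) if it holds outside a subset of some $B\in\tilde{\mathcal F}_T$ with $\tilde P[B]=0$; (in)equalities between random variables on $\tilde\Omega$ are understood q.s. Let $C(\tilde{\mathcal F}_t)$ be the set of $\tilde{\mathcal F}_t$-measurable random variables of the form $\varphi(\tilde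 W^t)$ with $\varphi:C_0\to\mathbb R$ continuous, and let $L^1_b(\tilde{\mathcal F}_t)$ be the set of $\tilde{\mathcal F}_t$-measurable $X$ with $\tilde E[|X|]<\infty$ such that $(X(\theta))_{\theta\in\Theta}$ is uniformly integrable. Condition (RCP): the set of the laws of $\tilde W(\theta)$, $\theta\in\Theta$, is relatively compact in the weak topology of probability measures on $C_0$. Let $S_t$ be the quasi-sure support of $\tilde W^t$, that is, the set of $x\in C_0$ such that $\tilde P[\tilde W^t\in U]>0$ for every neighbourhood $U$ of $x$. Proposition. Let $t\in[0,T]$, $\mathcal X\subseteq C(\tilde{\mathcal F}_t)$, and let $\varphi^*:C_0\to[-\infty,\infty]$ be the pointwise infimum of all continuous functions $\varphi:C_0\to\mathbb R$ such that $X=\varphi(\tilde W^t)$ for some $X\in\mathcal X$. Assume that $X^*=\varphi^*(\tilde W^t)\in C(\tilde{\mathcal F}_t)$. (i) For every $\theta\in\Theta$ there is a sequence $(X^n)$ in $\mathcal X$ such that $X^*(\theta)=\inf_n X^n(\theta)$ $P$-almost surely. (ii) Assume in addition that $\varphi^*$ is continuous on $S_t$, that (RCP) holds and that $\mathcal X$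 is directed downward (any two elements of $\mathcal X$ have a common lower bound in $\mathcal X$). Then there is a decreasing sequence $(X^n)$ in $\mathcal X$ such that $\lim_{n\to\infty}\tilde P[X^n-X^*\ge\varepsilon]=0$ for every $\varepsilon>0$; and if moreover $\mathcal X\subseteq L^1_b(\tilde{\mathcal F}_t)$ and $X^*\in L^1_b(\tilde{\mathcal F}_t)$, then also $\lim_{n\to\infty}\tilde E[X^n-X^*]=0$. -/

import Mathlib

open MeasureTheory ProbabilityTheory Filter Topology Set
open scoped NNReal ENNReal MatrixOrder

noncomputable section

namespace VolatilityUncertainty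

/-! ### Time interval and path space -/

/-- The time interval `[0, T]`. -/
abbrev Time (T : ℝ≥0) : Type := Set.Icc (0 : ℝ≥0) T

/-- The time `T` as an element of `[0, T]`. -/
def Time.last (T : ℝ≥0) : Time T := ⟨T, by simp⟩

/-- Lebesgue measure on `[0, T]`. -/
def Time.lebesgue (T : ℝ≥0) : Measure (Time T) :=
  (volume : Measure ℝ).comap fun s : Time T => ((s : ℝ≥0) : ℝ)

/-- `C₀([0,T]; ℝᵈ)`: continuous paths starting at `0`, with the topology of uniform convergence
(Mathlib's supremum metric on `C(K, E)` for compact `K`). -/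
abbrev PathSpace (d : ℕ) (T : ℝ≥0) : Type :=
  ({f | ∀ s : Time T, (s : ℝ≥0) = 0 → f s = 0} : Set C(Time T, EuclideanSpace ℝ (Fin d)))

instance (d : ℕ) (T : ℝ≥0) : MeasurableSpace (PathSpace d T) := borel _

instance (d : ℕ) (T : ℝ≥0) : BorelSpace (PathSpace d T) := ⟨rfl⟩

/-- The path `s ↦ x (s ∧ t)` stopped at time `t`. -/
def stopPath {d : ℕ} {T : ℝ≥0} (t : Time T) (x : PathSpace d T) : PathSpace d T :=
  ⟨x.1.comp ⟨fun s => min s t, by fun_prop⟩, fun s hs => by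
    refine x.2 _ ?_
    have h : min s t ≤ s := min_le_left s t
    exact le_antisymm ((Subtype.coe_le_coe.2 h).trans hs.le) zero_le⟩

/-! ### Brownian motion, its augmented filtration, the Itô integral -/

section Ito

variable {Ω : Type*} [mΩ : MeasurableSpace Ω] {d : ℕ} {T : ℝ≥0}

/-- `W` is a `d`-dimensional Brownian motion: its coordinates are independent real Brownian
motions. -/
structure IsBrownianMotion (W : ℝ≥0 → Ω → EuclideanSpace ℝ (Fin d)) (P : Measure Ω) : Prop where
  measurable : ∀ t, Measurable (W t)
  coord : ∀ i, IsBrownianReal (fun t ω => W t ω i) P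
  indep : iIndepFun (fun (i : Fin d) (ω : Ω) (t : ℝ≥0) => W t ω i) P

/-- The augmented filtration of `W` on `[0, T]`: at time `t` it is generated by `W_s`, `s ≤ t`,
and the `P`-null sets. -/
def brownianFiltration (P : Measure Ω) (W : ℝ≥0 → Ω → EuclideanSpace ℝ (Fin d))
    (hW : ∀ t, Measurable (W t)) (T : ℝ≥0) : Filtration (Time T) mΩ where
  seq t := (⨆ s : Set.Iic (t : ℝ≥0), MeasurableSpace.comap (W s) inferInstance) ⊔
    MeasurableSpace.generateFrom {A | MeasurableSet[mΩ] A ∧ P A = 0}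
  mono' t u htu := by
    refine sup_le_sup_right (iSup_le fun s => ?_) _
    exact le_iSup (fun s : Set.Iic (u : ℝ≥0) => MeasurableSpace.comap (W s) inferInstance)
      ⟨s.1, (Set.mem_Iic.1 s.2).trans (Subtype.coe_le_coe.2 htu)⟩
  le' t := sup_le (iSup_le fun s => (hW s).comap_le)
    (MeasurableSpace.generateFrom_le fun _ hA => hA.1)

/-- The squared Frobenius norm of a matrix. -/
def frobSq (A : Matrix (Fin d) (Fin d) ℝ) : ℝ := ∑ i, ∑ j, A i j ^ 2

/-- Matrix-valued simple processes `∑ i < n, ξ i • 1_{(τ i, τ (i + 1)]}` with bounded coefficients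
`ξ i` that are measurable at time `τ i`. -/
structure SimpleProcess (ℱ : Filtration (Time T) mΩ) (d : ℕ) where
  n : ℕ
  τ : ℕ → Time T
  mono : Monotone τ
  ξ : ℕ → Ω → Matrix (Fin d) (Fin d) ℝ
  meas : ∀ i a b, Measurable[ℱ (τ i)] fun ω => ξ i ω a b
  bdd : ∃ C : ℝ, ∀ i ω a b, |ξ i ω a b| ≤ C

/-- The value at time `s` of a simple process. -/
def SimpleProcess.val {ℱ : Filtration (Time T) mΩ} (H : SimpleProcess ℱ d) (s : Time T) (ω : Ω) :
    Matrix (Fin d) (Fin d) ℝ :=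
  ∑ i ∈ Finset.range H.n, (Set.Ioc (H.τ i) (H.τ (i + 1))).indicator (fun _ => H.ξ i ω) s

/-- The elementary stochastic integral `∫₀ᵗ H dW` of a simple process. -/
def SimpleProcess.integral {ℱ : Filtration (Time T) mΩ} (H : SimpleProcess ℱ d)
    (W : ℝ≥0 → Ω → EuclideanSpace ℝ (Fin d)) (t : Time T) (ω : Ω) : EuclideanSpace ℝ (Fin d) :=
  ∑ i ∈ Finset.range H.n, Matrix.toEuclideanLin (H.ξ i ω)
    (W (min (H.τ (i + 1)) t : Time T) ω - W (min (H.τ i) t : Time T) ω)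

/-- `M` is (a continuous version of) the Itô integral `∫ H dW` on `[0, T]`: `M` is continuous,
started at `0`, adapted, and a limit, uniformly on `[0, T]` in probability, of elementary
integrals of simple processes `Hₙ` such that `∫₀ᵀ ‖Hₙ - H‖² ds → 0` in probability. This
determines `M` up to indistinguishability. -/
structure IsItoIntegral (P : Measure Ω) (W : ℝ≥0 → Ω → EuclideanSpace ℝ (Fin d))
    (ℱ : Filtration (Time T) mΩ) (H : Time T → Ω → Matrix (Fin d) (Fin d) ℝ)
    (M : Ω → PathSpace d T) : Prop where
  adapted : ∀ t : Time T, Measurable[ℱ t] fun ω => (M ω).1 t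
  limit : ∃ S : ℕ → SimpleProcess ℱ d,
    (∀ ε : ℝ, 0 < ε → Tendsto (fun n => P {ω | ENNReal.ofReal ε ≤
      ∫⁻ s : Time T, ENNReal.ofReal (frobSq ((S n).val s ω - H s ω)) ∂(Time.lebesgue T)})
      atTop (𝓝 0)) ∧
    (∀ ε : ℝ, 0 < ε → Tendsto (fun n => P {ω | ∃ t : Time T,
      ε ≤ ‖(S n).integral W t ω - (M ω).1 t‖}) atTop (𝓝 0))

/-- Volatility processes: progressively measurable processes with values in the symmetric positive
definite matrices such that `∫₀ᵀ ‖θ^{1/2}‖² ds < ∞` almost surely. -/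
structure IsVolatility (P : Measure Ω) (ℱ : Filtration (Time T) mΩ)
    (θ : Time T → Ω → Matrix (Fin d) (Fin d) ℝ) : Prop where
  posDef : ∀ s ω, (θ s ω).PosDef
  progressive : IsStronglyProgressive ℱ θ
  integrable : ∀ᵐ ω ∂P,
    ∫⁻ s : Time T, ENNReal.ofReal (frobSq (CFC.sqrt (θ s ω))) ∂(Time.lebesgue T) < ∞

end Ito

/-! ### Volatility uncertainty on `Ω × Θ` -/

section Uncertainty

variable {Ω : Type*} [mΩ : MeasurableSpace Ω] {d : ℕ} {T : ℝ≥0} {Θ : Type*}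

/-- The raw filtration `σ(W̃_s ; s ≤ t)` on `Ω × Θ`. -/
@[reducible] def tildeF (Wt : Θ → Ω → PathSpace d T) (t : Time T) : MeasurableSpace (Ω × Θ) :=
  ⨆ s : Set.Iic t, MeasurableSpace.comap (fun z : Ω × Θ => (Wt z.2 z.1).1 s) inferInstance

/-- The stopped process `W̃ᵗ` as a map from `Ω × Θ` to path space. -/
def stopped (Wt : Θ → Ω → PathSpace d T) (t : Time T) (z : Ω × Θ) : PathSpace d T :=
  stopPath t (Wt z.2 z.1)

/-- The set function `P̃[A] = sup_θ P[A(θ)]`. -/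
def cap (P : Measure Ω) (A : Set (Ω × Θ)) : ℝ≥0∞ := ⨆ θ : Θ, P {ω | (ω, θ) ∈ A}

/-- Polar sets. -/
def IsPolar (P : Measure Ω) (Wt : Θ → Ω → PathSpace d T) (A : Set (Ω × Θ)) : Prop :=
  ∃ B : Set (Ω × Θ), MeasurableSet[tildeF Wt (Time.last T)] B ∧ A ⊆ B ∧ cap P B = 0

/-- A property holds quasi-surely if it holds outside a polar set. -/
def QuasiSurely (P : Measure Ω) (Wt : Θ → Ω → PathSpace d T) (p : Ω × Θ → Prop) : Prop :=
  IsPolar P Wt {z | ¬ p z}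

/-- The expectation `E[Y] = E[Y⁺] - E[Y⁻]` in the extended reals. -/
def expect (P : Measure Ω) (Y : Ω → ℝ) : EReal :=
  ((∫⁻ ω, ENNReal.ofReal (Y ω) ∂P : ℝ≥0∞) : EReal) -
    ((∫⁻ ω, ENNReal.ofReal (-Y ω) ∂P : ℝ≥0∞) : EReal)

/-- The upper expectation `Ẽ[X] = sup_θ E[X(θ)]`. -/
def upperExp (P : Measure Ω) (X : Ω × Θ → ℝ) : EReal := ⨆ θ : Θ, expect P fun ω => X (ω, θ)

/-- (Representatives of) the elements of `L¹_b(F̃_t)`: the `F̃_t`-measurable `X` with `Ẽ[|X|] < ∞`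
for which `(X(θ))_θ` is uniformly integrable. -/
structure MemL1b (P : Measure Ω) (Wt : Θ → Ω → PathSpace d T) (t : Time T) (X : Ω × Θ → ℝ) :
    Prop where
  measurable : Measurable[tildeF Wt t] X
  finite : upperExp P (fun z => |X z|) < ⊤
  unifIntegrable : UniformIntegrable (fun (θ : Θ) (ω : Ω) => X (ω, θ)) 1 P

/-- (Representatives of) the elements of `C(F̃_t)`: the `F̃_t`-measurable `X` which are quasi-surely
of the form `φ(W̃ᵗ)` with `φ` continuous. -/
def contRV (P : Measure Ω) (Wt : Θ → Ω → PathSpace d T) (t : Time T) : Set (Ω × Θ → ℝ) :=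
  {X | Measurable[tildeF Wt t] X ∧
    ∃ φ : C(PathSpace d T, ℝ), QuasiSurely P Wt fun z => X z = φ (stopped Wt t z)}

/-- The pointwise infimum, in the extended reals, over all continuous functions `φ` such that
`φ(W̃ᵗ)` is quasi-surely equal to some element of `𝒳`. -/
def infFun (P : Measure Ω) (Wt : Θ → Ω → PathSpace d T) (t : Time T) (𝒳 : Set (Ω × Θ → ℝ))
    (x : PathSpace d T) : EReal :=
  ⨅ φ ∈ {φ : C(PathSpace d T, ℝ) | ∃ X ∈ 𝒳, QuasiSurely P Wt fun z => X z = φ (stopped Wt t z)},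
    ((φ x : ℝ) : EReal)

/-- The quasi-sure support of `W̃ᵗ`: the paths all of whose neighbourhoods are charged by `W̃ᵗ`
with positive capacity. -/
def qsSupport (P : Measure Ω) (Wt : Θ → Ω → PathSpace d T) (t : Time T) : Set (PathSpace d T) :=
  {x | ∀ U ∈ 𝓝 x, cap P {z | stopped Wt t z ∈ U} ≠ 0}

/-- (RCP): the laws of `W̃(θ)`, `θ ∈ Θ`, form a relatively compact set of probability measures on
path space for the weak topology. -/
def RCP (P : Measure Ω) (Wt : Θ → Ω → PathSpace d T) : Prop :=
  IsCompact (closure {μ : ProbabilityMeasure (PathSpace d T) |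
    ∃ θ : Θ, (μ : Measure (PathSpace d T)) = P.map (Wt θ)})

/-- `𝒳` is directed downward for the quasi-sure order. -/
def DirectedDownward (P : Measure Ω) (Wt : Θ → Ω → PathSpace d T) (𝒳 : Set (Ω × Θ → ℝ)) : Prop :=
  ∀ X ∈ 𝒳, ∀ Y ∈ 𝒳, ∃ Z ∈ 𝒳, QuasiSurely P Wt (fun z => Z z ≤ X z) ∧
    QuasiSurely P Wt (fun z => Z z ≤ Y z)

end Uncertainty

end VolatilityUncertainty

end

open VolatilityUncertainty

/-! ### General topology and measure theory -/

/-- In a separable metric space, measurability can be tested on the distances to points. -/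
theorem measurable_of_measurable_dist {α β : Type*} [MeasurableSpace α] [PseudoMetricSpace β]
    [SecondCountableTopology β] [MeasurableSpace β] [BorelSpace β] {f : α → β}
    (hf : ∀ y, Measurable fun a => dist (f a) y) : Measurable f := by
  refine measurable_of_isOpen fun U hU => ?_
  choose! r hr hrU using Metric.isOpen_iff.1 hU
  obtain ⟨S, hSU, hS, hcov⟩ := TopologicalSpace.isOpen_biUnion_countable U
    (fun x => Metric.ball x (r x)) fun _ _ => Metric.isOpen_ball
  have hUeq : U = ⋃ x ∈ S, Metric.ball x (r x) := by
    rw [hcov]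
    exact Subset.antisymm (fun x hx => mem_biUnion hx (Metric.mem_ball_self (hr x hx)))
      (iUnion₂_subset hrU)
  rw [hUeq, preimage_iUnion₂]
  exact MeasurableSet.biUnion hS fun x _ => measurableSet_lt (hf x) measurable_const

/-- A map into `C(K, E)`, restricted to a subset, is measurable as soon as its evaluations are. -/
theorem measurable_of_measurable_eval {α K E : Type*} [MeasurableSpace α] [TopologicalSpace K]
    [CompactSpace K] [TopologicalSpace.SeparableSpace K] [MetricSpace E] [MeasurableSpace E]
    [OpensMeasurableSpace E] {s : Set C(K, E)} [SecondCountableTopology s] [MeasurableSpace s]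
    [BorelSpace s] {f : α → s} (hf : ∀ k, Measurable fun a => (f a).1 k) : Measurable f := by
  refine measurable_of_measurable_dist fun y => measurable_of_Iic fun r => ?_
  obtain ⟨D, hD, hDd⟩ := TopologicalSpace.exists_countable_dense K
  rcases lt_or_ge r 0 with hr | hr
  · convert MeasurableSet.empty
    exact eq_empty_of_forall_notMem fun a ha => (dist_nonneg.trans ha).not_gt hr
  have : (fun a => dist (f a) y) ⁻¹' Iic r = ⋂ k ∈ D, {a | dist ((f a).1 k) (y.1 k) ≤ r} := by
    ext a
    simp only [mem_preimage, mem_Iic, mem_iInter, mem_ofPred_eq, Subtype.dist_eq,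
      ContinuousMap.dist_le hr]
    refine ⟨fun h k _ => h k, fun h k => ?_⟩
    have hc : IsClosed {k | dist ((f a).1 k) (y.1 k) ≤ r} :=
      isClosed_le (by fun_prop) continuous_const
    exact (hc.closure_subset_iff.2 h) (hDd k)
  rw [this]
  exact MeasurableSet.biInter hD fun k _ => by
    have : Measurable fun x : E => dist x (y.1 k) := (continuous_id.dist continuous_const).measurable
    exact measurableSet_le (this.comp (hf k)) measurable_const

/-- In a second countable space, the infimum of a family of continuous functions is the infimum of
a countable subfamily. -/
theorem exists_seq_iInf_eq {α : Type*} [TopologicalSpace α] [SecondCountableTopology α]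
    {Φ : Set C(α, ℝ)} (hΦ : Φ.Nonempty) :
    ∃ φ : ℕ → C(α, ℝ), (∀ n, φ n ∈ Φ) ∧
      ∀ x, ⨅ n, ((φ n x : ℝ) : EReal) = ⨅ ψ ∈ Φ, ((ψ x : ℝ) : EReal) := by
  have hcount (q : ℚ) := TopologicalSpace.isOpen_biUnion_countable Φ
    (fun ψ => {x | ψ x < (q : ℝ)}) fun ψ _ => isOpen_lt ψ.continuous continuous_const
  choose S hSΦ hS hcov using hcount
  obtain ⟨φ₀, hφ₀⟩ := hΦ
  have hR : (insert φ₀ (⋃ q, S q)).Countable := (countable_iUnion hS).insert _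
  obtain ⟨φ, hφ⟩ := hR.exists_eq_range (insert_nonempty _ _)
  have hmem : ∀ n, φ n ∈ Φ := fun n => by
    have : φ n ∈ insert φ₀ (⋃ q, S q) := hφ ▸ mem_range_self n
    rcases this with h | h
    · exact h ▸ hφ₀
    · obtain ⟨q, hq⟩ := mem_iUnion.1 h
      exact hSΦ q hq
  refine ⟨φ, hmem, fun x => le_antisymm ?_ (le_iInf fun n => iInf₂_le _ (hmem n))⟩
  refine le_iInf₂ fun ψ hψ => le_of_forall_gt fun c hc => ?_
  obtain ⟨q, hq, hqc⟩ := EReal.lt_iff_exists_rat_btwn.1 hc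
  have hx : x ∈ ⋃ ψ ∈ Φ, {x | ψ x < (q : ℝ)} := mem_biUnion hψ (EReal.coe_lt_coe_iff.1 hq)
  rw [← hcov q] at hx
  obtain ⟨χ, hχ, hχx⟩ := mem_iUnion₂.1 hx
  obtain ⟨n, rfl⟩ : χ ∈ range φ := hφ ▸ Or.inr (mem_iUnion.2 ⟨q, hχ⟩)
  exact (iInf_le _ n).trans_lt ((EReal.coe_lt_coe_iff.2 hχx).trans hqc)

/-- The measure of a closed set is an upper semicontinuous function of the probability measure. -/
theorem isOpen_setOf_measure_lt {α : Type*} [MeasurableSpace α] [TopologicalSpace α]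
    [OpensMeasurableSpace α] [HasOuterApproxClosed α] {F : Set α} (hF : IsClosed F) (δ : ℝ≥0∞) :
    IsOpen {μ : ProbabilityMeasure α | (μ : Measure α) F < δ} := by
  rw [isOpen_iff_mem_nhds]
  intro μ hμ
  exact eventually_lt_of_limsup_lt
    ((ProbabilityMeasure.limsup_measure_closed_le_of_tendsto tendsto_id hF).trans_lt hμ)

/-- A decreasing sequence of closed sets with empty intersection has uniformly small measure on a
relatively compact set of probability measures. -/
theorem exists_forall_measure_lt {α : Type*} [MeasurableSpace α] [TopologicalSpace α]
    [OpensMeasurableSpace α] [HasOuterApproxClosed α] {M : Set (ProbabilityMeasure α)}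
    (hM : IsCompact (closure M)) {F : ℕ → Set α} (hF : ∀ n, IsClosed (F n)) (hanti : Antitone F)
    (hempty : ⋂ n, F n = ∅) {δ : ℝ≥0∞} (hδ : 0 < δ) :
    ∃ N, ∀ n ≥ N, ∀ μ ∈ M, (μ : Measure α) (F n) < δ := by
  have hcover : ∀ μ : ProbabilityMeasure α, ∃ n, (μ : Measure α) (F n) < δ := fun μ => by
    have h := tendsto_measure_iInter_atTop (μ := (μ : Measure α))
      (fun n => (hF n).measurableSet.nullMeasurableSet) hanti ⟨0, measure_ne_top _ _⟩
    rw [hempty, measure_empty] at h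
    exact (h.eventually_lt_const hδ).exists
  obtain ⟨N, hN⟩ := hM.elim_directed_cover
    (fun n => {μ : ProbabilityMeasure α | (μ : Measure α) (F n) < δ})
    (fun n => isOpen_setOf_measure_lt (hF n) δ) (fun μ _ => mem_iUnion.2 (hcover μ))
    (directed_of_isDirected_le fun m n hmn μ hμ =>
      lt_of_le_of_lt (measure_mono (hanti hmn)) hμ)
  exact ⟨N, fun n hn μ hμ => (measure_mono (hanti hn)).trans_lt (hN (subset_closure hμ))⟩

/-- `ε`-`δ` bound for the integral of a nonnegative function below a member of a uniformly
integrable family. -/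
theorem lintegral_ofReal_le_add {Ω : Type*} [MeasurableSpace Ω] {P : Measure Ω}
    [IsProbabilityMeasure P] {f g : Ω → ℝ} {ε η : ℝ} (hf : Measurable f)
    (hfg : ∀ᵐ ω ∂P, f ω ≤ g ω)
    (hg : eLpNorm ({ω | ε ≤ f ω}.indicator g) 1 P ≤ ENNReal.ofReal η) :
    ∫⁻ ω, ENNReal.ofReal (f ω) ∂P ≤ ENNReal.ofReal ε + ENNReal.ofReal η := by
  have hA : MeasurableSet {ω | ε ≤ f ω} := measurableSet_le measurable_const hf
  calc ∫⁻ ω, ENNReal.ofReal (f ω) ∂P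
      ≤ ∫⁻ ω, (ENNReal.ofReal ε + ‖{ω | ε ≤ f ω}.indicator g ω‖ₑ) ∂P := by
        refine lintegral_mono_ae (hfg.mono fun ω h => ?_)
        by_cases hω : ε ≤ f ω
        · rw [indicator_of_mem (show ω ∈ {ω | ε ≤ f ω} from hω)]
          refine le_add_left ?_
          rw [← ofReal_norm]
          exact ENNReal.ofReal_le_ofReal (h.trans (le_abs_self _))
        · exact le_add_right (ENNReal.ofReal_le_ofReal (not_le.1 hω).le)
    _ = ENNReal.ofReal ε + eLpNorm ({ω | ε ≤ f ω}.indicator g) 1 P := by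
        rw [lintegral_add_left measurable_const, lintegral_const, measure_univ, mul_one,
          eLpNorm_one_eq_lintegral_enorm]
    _ ≤ _ := by gcongr

namespace VolatilityUncertainty

section Uncertainty

variable {Ω : Type*} [mΩ : MeasurableSpace Ω] {d : ℕ} {T : ℝ≥0} {Θ : Type*} {P : Measure Ω}
  {Wt : Θ → Ω → PathSpace d T} {t : Time T} {𝒳 : Set (Ω × Θ → ℝ)}

theorem continuous_stopPath (t : Time T) :
    Continuous (stopPath t : PathSpace d T → PathSpace d T) :=
  Continuous.subtype_mk ((ContinuousMap.continuous_precomp _).comp continuous_subtype_val) _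

theorem IsItoIntegral.measurable {W : ℝ≥0 → Ω → EuclideanSpace ℝ (Fin d)}
    {ℱ : Filtration (Time T) mΩ} {H : Time T → Ω → Matrix (Fin d) (Fin d) ℝ}
    {M : Ω → PathSpace d T} (h : IsItoIntegral P W ℱ H M) : Measurable M :=
  measurable_of_measurable_eval fun s => (h.adapted s).mono (ℱ.le s) le_rfl

theorem measurable_section (hm : ∀ θ, Measurable (Wt θ)) {X : Ω × Θ → ℝ}
    (hX : Measurable[tildeF Wt t] X) (θ : Θ) : Measurable fun ω => X (ω, θ) := by
  have h : Measurable[mΩ, tildeF Wt t] fun ω => (ω, θ) := by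
    rw [measurable_iff_comap_le, MeasurableSpace.comap_iSup]
    refine iSup_le fun s => ?_
    rw [MeasurableSpace.comap_comp]
    have hev : Continuous fun x : PathSpace d T => x.1 s.1 := by fun_prop
    exact (hev.measurable.comp (hm θ)).comap_le
  exact hX.comp h

theorem cap_eq_zero_iff {A : Set (Ω × Θ)} : cap P A = 0 ↔ ∀ θ, P {ω | (ω, θ) ∈ A} = 0 := by
  simp [cap]

theorem QuasiSurely.ae {p : Ω × Θ → Prop} (h : QuasiSurely P Wt p) (θ : Θ) :
    ∀ᵐ ω ∂P, p (ω, θ) := by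
  obtain ⟨B, -, hB, h0⟩ := h
  exact measure_mono_null (fun ω hω => hB hω) (cap_eq_zero_iff.1 h0 θ)

/-- The quasi-sure support is closed. -/
theorem isClosed_qsSupport : IsClosed (qsSupport P Wt t) := by
  rw [← isOpen_compl_iff, isOpen_iff_mem_nhds]
  intro x hx
  simp only [qsSupport, mem_compl_iff, mem_ofPred_eq, not_forall, not_not] at hx
  obtain ⟨U, hU, h0⟩ := hx
  filter_upwards [eventually_mem_nhds_iff.2 hU] with y hy hys
  exact hys U hy h0

/-- The stopped process stays in its quasi-sure support. -/
theorem ae_stopped_mem_qsSupport (θ : Θ) :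
    ∀ᵐ ω ∂P, stopped Wt t (ω, θ) ∈ qsSupport P Wt t := by
  have h : ∀ x ∈ (qsSupport P Wt t)ᶜ, ∃ U : Set (PathSpace d T), IsOpen U ∧ x ∈ U ∧
      cap P {z | stopped Wt t z ∈ U} = 0 := by
    intro x hx
    simp only [qsSupport, mem_compl_iff, mem_ofPred_eq, not_forall, not_not] at hx
    obtain ⟨U, hU, h0⟩ := hx
    obtain ⟨V, hVU, hV, hxV⟩ := mem_nhds_iff.1 hU
    refine ⟨V, hV, hxV, cap_eq_zero_iff.2 fun θ => ?_⟩
    exact measure_mono_null (fun ω hω => hVU hω) (cap_eq_zero_iff.1 h0 θ)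
  choose! U hUo hxU hU0 using h
  obtain ⟨S, hSs, hS, hcov⟩ := TopologicalSpace.isOpen_biUnion_countable
    (qsSupport P Wt t)ᶜ (fun x => U x ∩ (qsSupport P Wt t)ᶜ)
    fun x hx => (hUo x hx).inter isClosed_qsSupport.isOpen_compl
  refine measure_mono_null (t := ⋃ x ∈ S, {ω | stopped Wt t (ω, θ) ∈ U x}) (fun ω hω => ?_)
    ((measure_biUnion_null_iff hS).2 fun x hx => cap_eq_zero_iff.1 (hU0 x (hSs hx)) θ)
  have : stopped Wt t (ω, θ) ∈ ⋃ x ∈ (qsSupport P Wt t)ᶜ, U x ∩ (qsSupport P Wt t)ᶜ :=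
    mem_biUnion hω ⟨hxU _ hω, hω⟩
  rw [← hcov] at this
  obtain ⟨x, hx, hxω⟩ := mem_iUnion₂.1 this
  exact mem_biUnion hx hxω.1

/-- An almost sure property of the stopped process holds at points of the support arbitrarily close
to a given one. -/
theorem mem_closure_of_mem_qsSupport {p : PathSpace d T → Prop}
    (hp : ∀ θ, ∀ᵐ ω ∂P, p (stopped Wt t (ω, θ))) {x : PathSpace d T}
    (hx : x ∈ qsSupport P Wt t) : x ∈ closure {y ∈ qsSupport P Wt t | p y} := by
  rw [mem_closure_iff_nhds]
  intro U hU
  by_contra hne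
  rw [not_nonempty_iff_eq_empty] at hne
  refine hx U hU (cap_eq_zero_iff.2 fun θ => ?_)
  have h : ∀ᵐ ω ∂P, stopped Wt t (ω, θ) ∉ U := by
    filter_upwards [hp θ, ae_stopped_mem_qsSupport θ] with ω h1 h2 hU
    exact eq_empty_iff_forall_notMem.1 hne _ ⟨hU, h2, h1⟩
  simpa [ae_iff] using h

/-- Almost sure inequalities between continuous functions of the stopped process hold on its
quasi-sure support. -/
theorem le_on_qsSupport {φ ψ : C(PathSpace d T, ℝ)}
    (h : ∀ θ, ∀ᵐ ω ∂P, φ (stopped Wt t (ω, θ)) ≤ ψ (stopped Wt t (ω, θ)))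
    {x : PathSpace d T} (hx : x ∈ qsSupport P Wt t) : φ x ≤ ψ x :=
  (isClosed_le φ.continuous ψ.continuous).closure_subset_iff.2 (fun _ hy => hy.2)
    (mem_closure_of_mem_qsSupport (p := fun x => φ x ≤ ψ x) h hx)

/-- Almost sure equality of functions which are continuous on the quasi-sure support extends to the
whole support. -/
theorem eqOn_qsSupport {E : Type*} [TopologicalSpace E] [T2Space E] {f g : PathSpace d T → E}
    (hf : ContinuousOn f (qsSupport P Wt t)) (hg : ContinuousOn g (qsSupport P Wt t))
    (h : ∀ θ, ∀ᵐ ω ∂P, f (stopped Wt t (ω, θ)) = g (stopped Wt t (ω, θ))) :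
    EqOn f g (qsSupport P Wt t) := by
  refine Set.EqOn.of_subset_closure (s := {y ∈ qsSupport P Wt t | f y = g y}) (fun y hy => hy.2)
    hf hg (fun y hy => hy.1) fun x hx => ?_
  exact mem_closure_of_mem_qsSupport (p := fun x => f x = g x) h hx

/-- The infimum of the admissible continuous functions is attained along a sequence. -/
theorem exists_seq_infFun (h𝒳 : 𝒳 ⊆ contRV P Wt t) (hne : 𝒳.Nonempty) :
    ∃ (X : ℕ → Ω × Θ → ℝ) (φ : ℕ → C(PathSpace d T, ℝ)), (∀ n, X n ∈ 𝒳) ∧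
      (∀ n, QuasiSurely P Wt fun z => X n z = φ n (stopped Wt t z)) ∧
      ∀ x, ⨅ n, ((φ n x : ℝ) : EReal) = infFun P Wt t 𝒳 x := by
  obtain ⟨X, hX⟩ := hne
  obtain ⟨φ, hφ, hinf⟩ := exists_seq_iInf_eq
    (Φ := {φ : C(PathSpace d T, ℝ) |
      ∃ X ∈ 𝒳, QuasiSurely P Wt fun z => X z = φ (stopped Wt t z)})
    (by obtain ⟨φ, hφ⟩ := (h𝒳 hX).2; exact ⟨φ, X, hX, hφ⟩)
  choose X hX hXφ using hφ
  exact ⟨X, φ, hX, hXφ, hinf⟩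

theorem nonempty_of_eq_infFun [IsProbabilityMeasure P] [Nonempty Θ] {Xstar : Ω × Θ → ℝ}
    (hinf : QuasiSurely P Wt fun z =>
      ((Xstar z : ℝ) : EReal) = infFun P Wt t 𝒳 (stopped Wt t z)) : 𝒳.Nonempty := by
  by_contra h
  rw [not_nonempty_iff_eq_empty] at h
  subst h
  obtain ⟨ω, hω⟩ := (hinf.ae (Classical.arbitrary Θ)).exists
  simp [infFun] at hω

theorem isGLB_range_of_coe_eq_iInf {a : ℝ} {f : ℕ → ℝ} (h : (a : EReal) = ⨅ n, (f n : EReal)) :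
    IsGLB (range f) a := by
  refine ⟨?_, fun b hb => ?_⟩
  · rintro _ ⟨n, rfl⟩
    exact EReal.coe_le_coe_iff.1 (h ▸ iInf_le _ n)
  · exact EReal.coe_le_coe_iff.1 (h ▸ le_iInf fun n => EReal.coe_le_coe_iff.2 (hb ⟨n, rfl⟩))

theorem exists_seq_isGLB [IsProbabilityMeasure P] [Nonempty Θ] (h𝒳 : 𝒳 ⊆ contRV P Wt t)
    {Xstar : Ω × Θ → ℝ} (hinf : QuasiSurely P Wt fun z =>
      ((Xstar z : ℝ) : EReal) = infFun P Wt t 𝒳 (stopped Wt t z)) :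
    ∃ X : ℕ → Ω × Θ → ℝ, (∀ n, X n ∈ 𝒳) ∧
      ∀ θ, ∀ᵐ ω ∂P, IsGLB (range fun n => X n (ω, θ)) (Xstar (ω, θ)) := by
  obtain ⟨X, φ, hX, hXφ, hφ⟩ := exists_seq_infFun h𝒳 (nonempty_of_eq_infFun hinf)
  refine ⟨X, hX, fun θ => ?_⟩
  filter_upwards [hinf.ae θ, ae_all_iff.2 fun n => (hXφ n).ae θ] with ω h1 h2
  refine isGLB_range_of_coe_eq_iInf ?_
  rw [h1, ← hφ]
  exact iInf_congr fun n => by rw [h2 n]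

theorem ae_le_of_eq_infFun (h𝒳 : 𝒳 ⊆ contRV P Wt t) {Xstar : Ω × Θ → ℝ}
    (hinf : QuasiSurely P Wt fun z =>
      ((Xstar z : ℝ) : EReal) = infFun P Wt t 𝒳 (stopped Wt t z)) {X : Ω × Θ → ℝ} (hX : X ∈ 𝒳)
    (θ : Θ) : ∀ᵐ ω ∂P, Xstar (ω, θ) ≤ X (ω, θ) := by
  obtain ⟨φ, hφ⟩ := (h𝒳 hX).2
  filter_upwards [hinf.ae θ, hφ.ae θ] with ω h1 h2
  refine EReal.coe_le_coe_iff.1 ?_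
  rw [h1, h2]
  exact iInf₂_le φ ⟨X, hX, hφ⟩

/-- A sequence in a downward directed set is dominated by a decreasing one. -/
theorem DirectedDownward.exists_decreasing (hdir : DirectedDownward P Wt 𝒳)
    {Y : ℕ → Ω × Θ → ℝ} (hY : ∀ n, Y n ∈ 𝒳) :
    ∃ X : ℕ → Ω × Θ → ℝ, (∀ n, X n ∈ 𝒳) ∧ (∀ n, QuasiSurely P Wt fun z => X (n + 1) z ≤ X n z) ∧
      ∀ n, QuasiSurely P Wt fun z => X (n + 1) z ≤ Y n z := by
  choose! Z hZ hZ1 hZ2 using hdir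
  let X : ℕ → Ω × Θ → ℝ := fun n => Nat.rec (Y 0) (fun k x => Z x (Y k)) n
  have hX : ∀ n, X n ∈ 𝒳 := fun n => by
    induction n with
    | zero => exact hY 0
    | succ n ih => exact hZ _ ih _ (hY n)
  exact ⟨X, hX, fun n => hZ1 _ (hX n) _ (hY n), fun n => hZ2 _ (hX n) _ (hY n)⟩

/-- Under relative compactness, the capacities of the events that the stopped process hits
decreasing closed sets with empty intersection tend to zero. -/
theorem tendsto_cap_zero [IsProbabilityMeasure P] (hm : ∀ θ, Measurable (Wt θ)) (hrcp : RCP P Wt)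
    {F : ℕ → Set (PathSpace d T)} (hF : ∀ n, IsClosed (F n)) (hanti : Antitone F)
    (hempty : ⋂ n, F n = ∅) {A : ℕ → Set (Ω × Θ)}
    (hA : ∀ n θ, ∀ᵐ ω ∂P, (ω, θ) ∈ A n → stopped Wt t (ω, θ) ∈ F n) :
    Tendsto (fun n => cap P (A n)) atTop (𝓝 0) := by
  rw [ENNReal.tendsto_nhds_zero]
  intro δ hδ
  obtain ⟨N, hN⟩ := exists_forall_measure_lt hrcp (F := fun n => stopPath t ⁻¹' F n)
    (fun n => (hF n).preimage (continuous_stopPath t)) (fun m n h => preimage_mono (hanti h))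
    (by rw [← preimage_iInter, hempty, preimage_empty]) hδ
  filter_upwards [eventually_ge_atTop N] with n hn
  refine iSup_le fun θ => ?_
  calc P {ω | (ω, θ) ∈ A n} ≤ P (Wt θ ⁻¹' (stopPath t ⁻¹' F n)) := measure_mono_ae (hA n θ)
    _ = P.map (Wt θ) (stopPath t ⁻¹' F n) := by
      rw [Measure.map_apply (hm θ)
        ((hF n).preimage (continuous_stopPath t)).measurableSet]
    _ ≤ δ := (hN n hn ⟨P.map (Wt θ), Measure.isProbabilityMeasure_map (hm θ).aemeasurable⟩
      ⟨θ, rfl⟩).le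

theorem tendsto_cap_sub [IsProbabilityMeasure P] (hm : ∀ θ, Measurable (Wt θ)) (hrcp : RCP P Wt)
    (h𝒳 : 𝒳 ⊆ contRV P Wt t) {Xstar : Ω × Θ → ℝ} (hXstar : Xstar ∈ contRV P Wt t)
    (hinf : QuasiSurely P Wt fun z =>
      ((Xstar z : ℝ) : EReal) = infFun P Wt t 𝒳 (stopped Wt t z))
    (hcont : ContinuousOn (infFun P Wt t 𝒳) (qsSupport P Wt t))
    {Y X : ℕ → Ω × Θ → ℝ} {φ : ℕ → C(PathSpace d T, ℝ)}
    (hYφ : ∀ n, QuasiSurely P Wt fun z => Y n z = φ n (stopped Wt t z))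
    (hφ : ∀ x, ⨅ n, ((φ n x : ℝ) : EReal) = infFun P Wt t 𝒳 x)
    (hX : ∀ n, X n ∈ 𝒳) (hdecr : ∀ n, QuasiSurely P Wt fun z => X (n + 1) z ≤ X n z)
    (hXY : ∀ n, QuasiSurely P Wt fun z => X (n + 1) z ≤ Y n z) {ε : ℝ} (hε : 0 < ε) :
    Tendsto (fun n => cap P {z | ε ≤ X n z - Xstar z}) atTop (𝓝 0) := by
  choose ψ hψ using fun n => (h𝒳 (hX n)).2
  obtain ⟨f, hf⟩ := hXstar.2
  have hψφ : ∀ n, ∀ x ∈ qsSupport P Wt t, ψ (n + 1) x ≤ φ n x := fun n x hx =>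
    le_on_qsSupport (fun θ => by
      filter_upwards [(hψ (n + 1)).ae θ, (hYφ n).ae θ, (hXY n).ae θ] with ω h1 h2 h3
      rwa [← h1, ← h2]) hx
  have hψanti : ∀ x ∈ qsSupport P Wt t, Antitone fun n => ψ n x := fun x hx =>
    antitone_nat_of_succ_le fun n => le_on_qsSupport (fun θ => by
      filter_upwards [(hψ (n + 1)).ae θ, (hψ n).ae θ, (hdecr n).ae θ] with ω h1 h2 h3
      rwa [← h1, ← h2]) hx
  have hstar : EqOn (infFun P Wt t 𝒳) (fun x => ((f x : ℝ) : EReal)) (qsSupport P Wt t) :=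
    eqOn_qsSupport hcont (continuous_coe_real_ereal.comp f.continuous).continuousOn fun θ => by
      filter_upwards [hinf.ae θ, hf.ae θ] with ω h1 h2
      rw [← h1, h2]
  refine tendsto_cap_zero (t := t) hm hrcp
    (F := fun n => qsSupport P Wt t ∩ {x | ε ≤ ψ n x - f x}) (fun n => ?_) (fun m n h x hx => ?_)
    (eq_empty_of_forall_notMem fun x hx => ?_) fun n θ => ?_
  · exact isClosed_qsSupport.inter
      (isClosed_le continuous_const ((ψ n).continuous.sub f.continuous))
  · exact ⟨hx.1, hx.2.trans (sub_le_sub_right (hψanti x hx.1 h) _)⟩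
  · rw [mem_iInter] at hx
    have hxS := (hx 0).1
    have hlt : ⨅ n, ((φ n x : ℝ) : EReal) < ((f x + ε : ℝ) : EReal) := by
      rw [hφ, hstar hxS]
      exact EReal.coe_lt_coe_iff.2 (by linarith)
    obtain ⟨n, hn⟩ := iInf_lt_iff.1 hlt
    have h1 := EReal.coe_lt_coe_iff.1 hn
    have h2 := hψφ n x hxS
    have h3 : ε ≤ ψ (n + 1) x - f x := (hx (n + 1)).2
    linarith
  · filter_upwards [ae_stopped_mem_qsSupport (P := P) (Wt := Wt) (t := t) θ, (hψ n).ae θ, hf.ae θ]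
      with ω h1 h2 h3 h4
    exact ⟨h1, by simpa [← h2, ← h3] using h4⟩

/-- For a decreasing, uniformly integrable sequence, convergence in capacity implies convergence of
the upper expectations. -/
theorem tendsto_upperExp_sub [IsProbabilityMeasure P] [Nonempty Θ] (hm : ∀ θ, Measurable (Wt θ))
    {X : ℕ → Ω × Θ → ℝ} {Xstar : Ω × Θ → ℝ} (hX : ∀ n, MemL1b P Wt t (X n))
    (hXstar : MemL1b P Wt t Xstar) (hle : ∀ n, ∀ θ, ∀ᵐ ω ∂P, Xstar (ω, θ) ≤ X n (ω, θ))
    (hdecr : ∀ n, QuasiSurely P Wt fun z => X (n + 1) z ≤ X n z)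
    (hcap : ∀ ε : ℝ, 0 < ε → Tendsto (fun n => cap P {z | ε ≤ X n z - Xstar z}) atTop (𝓝 0)) :
    Tendsto (fun n => upperExp P fun z => X n z - Xstar z) atTop (𝓝 0) := by
  have hexp : ∀ n θ, expect P (fun ω => X n (ω, θ) - Xstar (ω, θ)) =
      ((∫⁻ ω, ENNReal.ofReal (X n (ω, θ) - Xstar (ω, θ)) ∂P : ℝ≥0∞) : EReal) := fun n θ => by
    have h0 : ∫⁻ ω, ENNReal.ofReal (-(X n (ω, θ) - Xstar (ω, θ))) ∂P = 0 := by
      rw [lintegral_congr_ae (g := fun _ => 0), lintegral_zero]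
      filter_upwards [hle n θ] with ω h
      exact ENNReal.ofReal_of_nonpos (by linarith)
    rw [expect, h0]
    simp
  have hle0 : ∀ n θ, ∀ᵐ ω ∂P, X n (ω, θ) ≤ X 0 (ω, θ) := fun n θ => by
    filter_upwards [ae_all_iff.2 fun n => (hdecr n).ae θ] with ω h
    exact antitone_nat_of_succ_le (f := fun n => X n (ω, θ)) h (Nat.zero_le n)
  have hmeas : ∀ n θ, Measurable fun ω => X n (ω, θ) - Xstar (ω, θ) := fun n θ =>
    (measurable_section hm (hX n).measurable θ).sub (measurable_section hm hXstar.measurable θ)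
  have hUI : UnifIntegrable (fun (θ : Θ) ω => X 0 (ω, θ) - Xstar (ω, θ)) 1 P :=
    (hX 0).unifIntegrable.2.1.sub hXstar.unifIntegrable.2.1 le_rfl
      (hX 0).unifIntegrable.1 hXstar.unifIntegrable.1
  have hbound : ∀ η : ℝ, 0 < η → ∀ᶠ n in atTop,
      upperExp P (fun z => X n z - Xstar z) ≤ ((η + η : ℝ) : EReal) := fun η hη => by
    obtain ⟨δ, hδ, hUIδ⟩ := hUI hη
    filter_upwards [(ENNReal.tendsto_nhds_zero.1 (hcap η hη)) (ENNReal.ofReal δ)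
      (ENNReal.ofReal_pos.2 hδ)] with n hn
    refine iSup_le fun θ => ?_
    rw [hexp]
    have := lintegral_ofReal_le_add (ε := η) (η := η) (hmeas n θ)
      (g := fun ω => X 0 (ω, θ) - Xstar (ω, θ))
      ((hle0 n θ).mono fun ω h => sub_le_sub_right h _)
      (hUIδ θ _ (measurableSet_le measurable_const (hmeas n θ))
        ((le_iSup (fun θ : Θ => P {ω | η ≤ X n (ω, θ) - Xstar (ω, θ)}) θ).trans hn))
    rw [← ENNReal.ofReal_add hη.le hη.le] at this
    refine (EReal.coe_ennreal_le_coe_ennreal_iff.2 this).trans_eq ?_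
    rw [EReal.coe_ennreal_ofReal, max_eq_left (by positivity)]
  refine tendsto_order.2 ⟨fun a ha => Eventually.of_forall fun n => ha.trans_le ?_, fun a ha => ?_⟩
  · refine le_trans ?_ (le_iSup _ (Classical.arbitrary Θ))
    rw [hexp]
    exact EReal.coe_ennreal_nonneg _
  · obtain ⟨η, hη, hηa⟩ := EReal.lt_iff_exists_real_btwn.1 ha
    have hη := EReal.coe_pos.1 hη
    filter_upwards [hbound (η / 2) (half_pos hη)] with n hn
    rw [add_halves] at hn
    exact hn.trans_lt hηa

end Uncertainty

end VolatilityUncertainty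

theorem mainTheorem2 {Ω : Type*} [MeasurableSpace Ω] (P : Measure Ω) [IsProbabilityMeasure P]
    {d : ℕ} {T : ℝ≥0} (hT : 0 < T)
    (W : ℝ≥0 → Ω → EuclideanSpace ℝ (Fin d)) (hW : IsBrownianMotion W P)
    (Θ : Set (Time T → Ω → Matrix (Fin d) (Fin d) ℝ)) (hne : Θ.Nonempty)
    (hΘ : ∀ θ ∈ Θ, IsVolatility P (brownianFiltration P W hW.measurable T) θ)
    (Wt : Θ → Ω → PathSpace d T)
    (hWt : ∀ θ : Θ, IsItoIntegral P W (brownianFiltration P W hW.measurable T)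
      (fun s ω => CFC.sqrt (θ.1 s ω)) (Wt θ))
    (t : Time T) (𝒳 : Set (Ω × Θ → ℝ)) (h𝒳 : 𝒳 ⊆ contRV P Wt t)
    (Xstar : Ω × Θ → ℝ) (hXstar : Xstar ∈ contRV P Wt t)
    (hinf : QuasiSurely P Wt fun z => ((Xstar z : ℝ) : EReal) = infFun P Wt t 𝒳 (stopped Wt t z)) :
    (∀ θ : Θ, ∃ X : ℕ → Ω × Θ → ℝ, (∀ n, X n ∈ 𝒳) ∧
      ∀ᵐ ω ∂P, IsGLB (Set.range fun n => X n (ω, θ)) (Xstar (ω, θ))) ∧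
    (ContinuousOn (infFun P Wt t 𝒳) (qsSupport P Wt t) → RCP P Wt → DirectedDownward P Wt 𝒳 →
      ∃ X : ℕ → Ω × Θ → ℝ, (∀ n, X n ∈ 𝒳) ∧
        (∀ n, QuasiSurely P Wt fun z => X (n + 1) z ≤ X n z) ∧
        (∀ ε : ℝ, 0 < ε →
          Tendsto (fun n => cap P {z | ε ≤ X n z - Xstar z}) atTop (𝓝 0)) ∧
        ((∀ Y ∈ 𝒳, MemL1b P Wt t Y) → MemL1b P Wt t Xstar →
          Tendsto (fun n => upperExp P fun z => X n z - Xstar z) atTop (𝓝 0))) := by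
  have : Nonempty Θ := hne.to_subtype
  have hm : ∀ θ : Θ, Measurable (Wt θ) := fun θ => (hWt θ).measurable
  refine ⟨fun θ => ?_, fun hcont hrcp hdir => ?_⟩
  · obtain ⟨X, hX, hglb⟩ := exists_seq_isGLB h𝒳 hinf
    exact ⟨X, hX, hglb θ⟩
  · obtain ⟨Y, φ, hY, hYφ, hφ⟩ := exists_seq_infFun h𝒳 (nonempty_of_eq_infFun hinf)
    obtain ⟨X, hX, hdecr, hXY⟩ := hdir.exists_decreasing hY
    have hcap : ∀ ε : ℝ, 0 < ε →
        Tendsto (fun n => cap P {z | ε ≤ X n z - Xstar z}) atTop (𝓝 0) := fun ε hε =>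
      tendsto_cap_sub hm hrcp h𝒳 hXstar hinf hcont hYφ hφ hX hdecr hXY hε
    refine ⟨X, hX, hdecr, hcap, fun hL1 hL1star =>
      tendsto_upperExp_sub hm (fun n => hL1 _ (hX n)) hL1star (fun n θ => ?_) hdecr hcap⟩
    exact ae_le_of_eq_infFun h𝒳 hinf (hX n) θ
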